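/- Consider the single-input system $x(t+1)=Ax(t)+Bu(t)+w(t)$, $y(t)=Cx(t)+v(t)$, $t\ge 0$, with $x(t)\in\mathbb{R}^n$ ($n\ge 1$), $u(t)\in\mathbb{R}$, $y(t)\in\mathbb{R}^l$, where $(w(t))_t$ and $(v(t))_t$ are mutually independent sequences of independent random vectors with $w(t)\sim\mathcal N(0,W)$, $v(t)\sim\mathcal N(0,V)$, $W\succeq 0$, $V\succ 0$. Assume that $(A,B)$ and $(A,W^{1/2})$ are controllable and that $(A,C)$ is observable. Let $L_{\mathrm f}$ be the steady-state Kalman gain, $E=(I-L_{\mathrm f}C)A$, $F=(I-L_{\mathrm f}C)B$, $G=L_{\mathrm f}$. For $i=1,\dots,N$ let $Q_i\succeq 0$ and $R_i\succ 0$ be weights with $(A,Q_i^{1/2})$ observable, and let $K^i_{\mathrm{LQR}}$ be the corresponding infinite-horizon LQR gain. Assume that $(E,L_{\mathrm f})$ is controllable and that, for every $i$, $(E,K^i_{\mathrm{LQR}})$ is observable and $(E+FK^i_{\mathrm{LQR}},L_{\mathrm f})$ is controllable. Let $a=[a_0\ \cdots\ a_{n-1}]$ satisfy $E^n=a_0I+a_1E+\dots+a_{n-1}E^{n-1}$,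 put $F_u=[E^{n-1}F\ \cdots\ EF\ F]$, and let $\tilde M_u$ be the $n\times n$ block matrix whose $(r,s)$ block is $E^{r-s-1}F$ for $s<r$ and $0$ otherwise; let $F_y,\tilde M_y$ be defined in the same way with $G$ in place of $F$. The estimation matrix is $$L_{\mathrm{est}}=\begin{bmatrix}F_u-(a\otimes I_n)\tilde M_u & F_y-(a\otimes I_n)\tilde M_y\\ a & 0\end{bmatrix}\in\mathbb{R}^{(n+1)\times n(l+1)} .$$ For each $i$, the expert runs the LQG controller $\hat x(t+1)=E\hat x(t)+Fu(t)+Gy(t+1)$, $u(t)=K^i_{\mathrm{LQR}}\hat x(t)$, from initial states $x(0),\hat x(0)$ (deterministic or random) that are independent of $(w(t))_{t\ge 0}$ and $(v(t))_{t\ge 1}$. The expert trajectory $D_i$ consists of the resulting $u_i(t_i),\dots,u_i(t_i+T)$ and $y_i(t_i+1),\dots,y_i(t_i+T)$, for some $t_i\ge 0$. Let $c_s=T-n+1$, let $H^i_{n,c_s}$ be the matrix whose $j$-th column ($0\le j<c_s$) stacks $u_i(t_i+j),\dots,u_i(t_i+j+n-1),y_i(t_i+j+1),\dots,y_i(t_i+j+n)$,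 and let $\bar U^i_{c_s}=[u_i(t_i+n)\ \cdots\ u_i(t_i+n+c_s-1)]$. Write $M^\dagger$ for the Moore–Penrose pseudoinverse of $M$. Suppose that $T\ge n(l+2)-1$ and that the source tasks are diverse: $\bigcap_{i=1}^N\operatorname{Ker}(K^i)=\{0\}$, where $K^i=[K^i_{\mathrm{LQR}}\ \ 1]$. Then, almost surely, $$\operatorname{Ker}(L_{\mathrm{est}})=\bigcap_{i=1}^N\operatorname{Ker}\bigl(\bar U^i_{c_s}H^{i\,\dagger}_{n,c_s}\bigr).$$ Hence, almost surely, $L_{\mathrm{est}}$ is determined by the data up to left multiplication by an invertible matrix: the orthogonal complement of the right-hand side has dimension $n+1$, and for every matrix $\hat L_{\mathrm{est}}$ whose $n+1$ rows form a basis of it there is an invertible matrix $P$ with $L_{\mathrm{est}}=P\hat L_{\mathrm{est}}$. -/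

import Mathlib

open MeasureTheory ProbabilityTheory Matrix
open scoped MatrixOrder Kronecker

noncomputable section

namespace LQG

/-- The pair `(A, B)` is controllable: `[B, A B, …, A ^ (n - 1) B]` has rank `n`. -/
def IsControllable {n m : ℕ} (A : Matrix (Fin n) (Fin n) ℝ) (B : Matrix (Fin n) (Fin m) ℝ) :
    Prop :=
  (Matrix.of fun (i : Fin n) (p : Fin n × Fin m) => (A ^ (p.1 : ℕ) * B) i p.2).rank = n

/-- The pair `(A, C)` is observable: the matrix with block rows `C, C A, …, C A ^ (n - 1)` has
rank `n`. -/
def IsObservable {n l : ℕ} (A : Matrix (Fin n) (Fin n) ℝ) (C : Matrix (Fin l) (Fin n) ℝ) :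
    Prop :=
  (Matrix.of fun (p : Fin n × Fin l) (j : Fin n) => (C * A ^ (p.1 : ℕ)) p.2 j).rank = n

/-- `K` is the gain of the infinite-horizon linear quadratic regulator `u = K x` with state weight
`Q` and input weight `R`, obtained from the positive semidefinite solution of the algebraic Riccati
equation. -/
def IsLQRGain {n m : ℕ} (A : Matrix (Fin n) (Fin n) ℝ) (B : Matrix (Fin n) (Fin m) ℝ)
    (Q : Matrix (Fin n) (Fin n) ℝ) (R : Matrix (Fin m) (Fin m) ℝ)
    (K : Matrix (Fin m) (Fin n) ℝ) : Prop :=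
  ∃ P : Matrix (Fin n) (Fin n) ℝ, P.PosSemidef ∧
    P = Aᵀ * P * A - Aᵀ * P * B * (R + Bᵀ * P * B)⁻¹ * (Bᵀ * P * A) + Q ∧
    K = -((R + Bᵀ * P * B)⁻¹ * (Bᵀ * P * A))

/-- `L` is the steady-state Kalman filter gain for process noise covariance `W` and measurement
noise covariance `V`; `S` is the steady-state covariance of the one-step prediction error. -/
def IsKalmanGain {n l : ℕ} (A : Matrix (Fin n) (Fin n) ℝ) (C : Matrix (Fin l) (Fin n) ℝ)
    (W : Matrix (Fin n) (Fin n) ℝ) (V : Matrix (Fin l) (Fin l) ℝ)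
    (L : Matrix (Fin n) (Fin l) ℝ) : Prop :=
  ∃ S : Matrix (Fin n) (Fin n) ℝ, S.PosSemidef ∧
    S = A * S * Aᵀ - A * S * Cᵀ * (C * S * Cᵀ + V)⁻¹ * (C * S * Aᵀ) + W ∧
    L = S * Cᵀ * (C * S * Cᵀ + V)⁻¹

/-- The matrix `E = (I - L C) A` of the dynamic controller. -/
def ctrlE {n l : ℕ} (A : Matrix (Fin n) (Fin n) ℝ) (C : Matrix (Fin l) (Fin n) ℝ)
    (L : Matrix (Fin n) (Fin l) ℝ) : Matrix (Fin n) (Fin n) ℝ :=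
  (1 - L * C) * A

/-- The matrix `F = (I - L C) B` of the dynamic controller. -/
def ctrlF {n m l : ℕ} (B : Matrix (Fin n) (Fin m) ℝ) (C : Matrix (Fin l) (Fin n) ℝ)
    (L : Matrix (Fin n) (Fin l) ℝ) : Matrix (Fin n) (Fin m) ℝ :=
  (1 - L * C) * B

/-- A run of the plant `x(t+1) = A x(t) + B u(t) + w(t)`, `y(t) = C x(t) + v(t)` in closed loop with
the LQG controller `x̂(t+1) = E x̂(t) + F u(t) + L y(t+1)`, `u(t) = K x̂(t)`, where `w` and `v` are
independent white Gaussian noises with covariances `W` and `V`.  The initial plant and controller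
states are arbitrary (deterministic or random), and independent of the noise that acts later. -/
structure ExpertRun {Ω : Type*} [MeasurableSpace Ω] (μ : Measure Ω) {n m l : ℕ}
    (A : Matrix (Fin n) (Fin n) ℝ) (B : Matrix (Fin n) (Fin m) ℝ) (C : Matrix (Fin l) (Fin n) ℝ)
    (W : Matrix (Fin n) (Fin n) ℝ) (V : Matrix (Fin l) (Fin l) ℝ)
    (L : Matrix (Fin n) (Fin l) ℝ) (K : Matrix (Fin m) (Fin n) ℝ) where
  /-- process noise -/
  w : ℕ → Ω → EuclideanSpace ℝ (Fin n)
  /-- measurement noise -/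
  v : ℕ → Ω → EuclideanSpace ℝ (Fin l)
  /-- plant state -/
  x : ℕ → Ω → Fin n → ℝ
  /-- controller state (state estimate) -/
  xhat : ℕ → Ω → Fin n → ℝ
  /-- control input -/
  u : ℕ → Ω → Fin m → ℝ
  /-- measured output -/
  y : ℕ → Ω → Fin l → ℝ
  law_w : ∀ t, HasLaw (w t) (multivariateGaussian 0 W) μ
  law_v : ∀ t, HasLaw (v t) (multivariateGaussian 0 V) μ
  indep_w : iIndepFun w μ
  indep_v : iIndepFun v μ
  indep_w_v : IndepFun (fun ω t => w t ω) (fun ω t => v t ω) μ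
  aemeasurable_x_zero : AEMeasurable (x 0) μ
  aemeasurable_xhat_zero : AEMeasurable (xhat 0) μ
  indep_init : IndepFun (fun ω => (x 0 ω, xhat 0 ω))
    (fun ω => ((fun t => w t ω), (fun t => v (t + 1) ω))) μ
  x_succ : ∀ t ω, x (t + 1) ω = A *ᵥ x t ω + B *ᵥ u t ω + (w t ω).ofLp
  y_eq : ∀ t ω, y t ω = C *ᵥ x t ω + (v t ω).ofLp
  xhat_succ : ∀ t ω,
    xhat (t + 1) ω = ctrlE A C L *ᵥ xhat t ω + ctrlF B C L *ᵥ u t ω + L *ᵥ y (t + 1) ω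
  u_eq : ∀ t ω, u t ω = K *ᵥ xhat t ω

/-- The data matrix `H_{r,c}` at time `t`: column `j` stacks `u(t+j), …, u(t+j+r-1)` and
`y(t+1+j), …, y(t+j+r)`. -/
def dataMatrix {m l : ℕ} (u : ℕ → Fin m → ℝ) (y : ℕ → Fin l → ℝ) (t r c : ℕ) :
    Matrix ((Fin r × Fin m) ⊕ (Fin r × Fin l)) (Fin c) ℝ :=
  Matrix.of fun p j => Sum.elim (fun q => u (t + j + q.1) q.2) (fun q => y (t + 1 + j + q.1) q.2) p

/-- The matrix `Ū_c = [u(t+n), …, u(t+n+c-1)]`. -/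
def inputRow {m : ℕ} (u : ℕ → Fin m → ℝ) (t n c : ℕ) : Matrix (Fin m) (Fin c) ℝ :=
  Matrix.of fun s j => u (t + n + j) s

/-- `[E ^ (n-1) F, …, E F, F]` (this is `F_u`, and `F_y` when `F` is replaced by `G`). -/
def reachRow {n k : ℕ} (E : Matrix (Fin n) (Fin n) ℝ) (F : Matrix (Fin n) (Fin k) ℝ) :
    Matrix (Fin n) (Fin n × Fin k) ℝ :=
  Matrix.of fun i q => (E ^ (n - 1 - (q.1 : ℕ)) * F) i q.2

/-- The strictly lower block triangular Toeplitz matrix whose block `(r, s)` is `E ^ (r - s - 1) F`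
for `s < r` and zero otherwise (this is `M̃_u`, and `M̃_y` when `F` is replaced by `G`). -/
def toeplitz {n k : ℕ} (E : Matrix (Fin n) (Fin n) ℝ) (F : Matrix (Fin n) (Fin k) ℝ) :
    Matrix (Fin n × Fin n) (Fin n × Fin k) ℝ :=
  Matrix.of fun p q => if q.1 < p.1 then (E ^ ((p.1 : ℕ) - (q.1 : ℕ) - 1) * F) p.2 q.2 else 0

/-- `a ⊗ I_k` for a row vector `a`. -/
def rowKron {n : ℕ} (a : Fin n → ℝ) (k : ℕ) : Matrix (Fin k) (Fin n × Fin k) ℝ :=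
  (Matrix.replicateRow Unit a ⊗ₖ (1 : Matrix (Fin k) (Fin k) ℝ)).submatrix (Prod.mk ()) id

/-- The estimation matrix `L_est`. -/
def estimationMatrix {n m l : ℕ} (E : Matrix (Fin n) (Fin n) ℝ) (F : Matrix (Fin n) (Fin m) ℝ)
    (G : Matrix (Fin n) (Fin l) ℝ) (a : Fin n → ℝ) :
    Matrix (Fin n ⊕ Fin m) ((Fin n × Fin m) ⊕ (Fin n × Fin l)) ℝ :=
  Matrix.fromBlocks
    (reachRow E F - rowKron a n * toeplitz E F) (reachRow E G - rowKron a n * toeplitz E G)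
    (rowKron a m) 0

/-- The four Penrose conditions. -/
structure IsMoorePenrose {p q : Type*} [Fintype p] [Fintype q] (M : Matrix p q ℝ)
    (X : Matrix q p ℝ) : Prop where
  mul_mul_left : M * X * M = M
  mul_mul_right : X * M * X = X
  symm_left : (M * X)ᵀ = M * X
  symm_right : (X * M)ᵀ = X * M

theorem exists_isMoorePenrose {p q : Type*} [Fintype p] [Fintype q] (M : Matrix p q ℝ) :
    ∃ X : Matrix q p ℝ, IsMoorePenrose M X := by
  classical
  have hG : (Mᵀ * M).IsHermitian := by
    rw [Matrix.IsHermitian, conjTranspose_eq_transpose_of_trivial]; simp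
  obtain ⟨U, d, hU, hs⟩ : ∃ (U : Matrix q q ℝ) (d : q → ℝ), Uᵀ * U = 1 ∧
      Mᵀ * M = U * diagonal d * Uᵀ := by
    refine ⟨hG.eigenvectorUnitary, hG.eigenvalues, ?_, ?_⟩
    · have := Unitary.coe_star_mul_self hG.eigenvectorUnitary
      rwa [star_eq_conjTranspose, conjTranspose_eq_transpose_of_trivial] at this
    · have := hG.spectral_theorem
      rw [Unitary.conjStarAlgAut_apply, star_eq_conjTranspose,
        conjTranspose_eq_transpose_of_trivial] at this
      exact this
  set D : Matrix q q ℝ := diagonal d with hD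
  set J : Matrix q q ℝ := diagonal fun i => (d i)⁻¹ with hJ
  have hDt : Dᵀ = D := by simp [hD]
  have hJt : Jᵀ = J := by simp [hJ]
  have hcomm : D * J = J * D := by simp [hD, hJ, mul_comm]
  have hDJD : D * J * D = D := by
    simp only [hD, hJ, diagonal_mul_diagonal]
    congr 1; ext i; exact mul_inv_mul_cancel (d i)
  have hJDJ : J * D * J = J := by
    simp only [hD, hJ, diagonal_mul_diagonal]
    congr 1; ext i
    by_cases h : d i = 0 <;> simp [h]
  have hXM : U * J * Uᵀ * Mᵀ * M = U * (J * D) * Uᵀ := by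
    calc U * J * Uᵀ * Mᵀ * M = U * J * Uᵀ * (Mᵀ * M) := by simp only [Matrix.mul_assoc]
      _ = U * J * (Uᵀ * U) * D * Uᵀ := by rw [hs]; simp only [Matrix.mul_assoc]
      _ = U * (J * D) * Uᵀ := by rw [hU]; simp only [Matrix.mul_assoc, Matrix.one_mul]
  refine ⟨U * J * Uᵀ * Mᵀ, ?_, ?_, ?_, ?_⟩
  · have h0 : Mᵀ * M * (U * J * Uᵀ * Mᵀ * M - 1) = 0 := by
      rw [hXM, Matrix.mul_sub, Matrix.mul_one, hs]
      have : U * D * Uᵀ * (U * (J * D) * Uᵀ) = U * (D * J * D) * Uᵀ := by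
        calc _ = U * D * (Uᵀ * U) * (J * D) * Uᵀ := by simp only [Matrix.mul_assoc]
          _ = _ := by rw [hU]; simp only [Matrix.mul_assoc, Matrix.one_mul]
      rw [this, hDJD, sub_self]
    have h1 : M * (U * J * Uᵀ * Mᵀ * M - 1) = 0 := by
      rw [← conjTranspose_mul_self_mul_eq_zero, conjTranspose_eq_transpose_of_trivial]
      exact h0
    rw [Matrix.mul_sub, Matrix.mul_one, sub_eq_zero, ← Matrix.mul_assoc] at h1
    exact h1
  · rw [hXM]
    calc _ = U * J * D * (Uᵀ * U) * J * Uᵀ * Mᵀ := by simp only [Matrix.mul_assoc]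
      _ = U * (J * D * J) * Uᵀ * Mᵀ := by rw [hU]; simp only [Matrix.mul_assoc, Matrix.one_mul]
      _ = _ := by rw [hJDJ]
  · simp only [transpose_mul, transpose_transpose, hJt, Matrix.mul_assoc]
  · rw [hXM]
    simp only [transpose_mul, transpose_transpose, hJt, hDt, hcomm, Matrix.mul_assoc]

/-- The Moore–Penrose pseudoinverse. -/
def pinv {p q : Type*} [Fintype p] [Fintype q] (M : Matrix p q ℝ) : Matrix q p ℝ :=
  (exists_isMoorePenrose M).choose

/-- The kernel of a matrix. -/
def matKer {p q : Type*} [Fintype q] (M : Matrix p q ℝ) : Submodule ℝ (q → ℝ) :=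
  LinearMap.ker M.mulVecLin

/-- The rows of `M` form a basis of the orthogonal complement of `S` (for the standard inner
product). -/
def RowsBasisOrthogonal {p q : Type*} [Fintype q] (M : Matrix p q ℝ)
    (S : Submodule ℝ (q → ℝ)) : Prop :=
  LinearIndependent ℝ M.row ∧
    ∀ z : q → ℝ, z ∈ Submodule.span ℝ (Set.range M.row) ↔ ∀ s ∈ S, z ⬝ᵥ s = 0

/-- The intersection over the source tasks of `Ker (Ū_c H_{n,c}†)`, computed from the samples
`u(t_i), …, u(t_i+T)` and `y(t_i+1), …, y(t_i+T)` of each task `i`, with `c = T - n + 1`. -/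
def dataKernel {N m l : ℕ} (n T : ℕ) (t : Fin N → ℕ) (u : Fin N → ℕ → Fin m → ℝ)
    (y : Fin N → ℕ → Fin l → ℝ) : Submodule ℝ ((Fin n × Fin m) ⊕ (Fin n × Fin l) → ℝ) :=
  ⨅ i, matKer (inputRow (u i) (t i) n (T - n + 1) *
    pinv (dataMatrix (u i) (y i) (t i) n (T - n + 1)))

end LQG

end

namespace LQG

/-! ### Rank conditions as annihilation and spanning statements. -/

section Rank

variable {n m l : ℕ}

/-! Write `H` for a task's data matrix and `Ū` for its input row. Since `a` cancels the contribution
of the initial state, `L_est` sends a column of `H` to `x̂(n) - ∑ a_k x̂(k)` stacked on `∑ a_k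
u(k)`, with time counted from the start of that column. As `u = K x̂`, applying `[K 1]` leaves
`u(n)`, so `Ū = [K 1] L_est H` (`inputRow_eq`). If `H` has full row rank, then `H H† = 1` and `Ū H†
= [K 1] L_est`. Diversity then makes the intersection of the kernels equal to `Ker L_est`. The rows
of `L_est` are independent (`linearIndependent_row_estimationMatrix`, with `a ≠ 0` from
`coeff_ne_zero`), so any basis of the orthogonal complement of the kernel differs from them by an
invertible matrix.

The probabilistic part is the full row rank of `H`. By observability of `(E, K)` it suffices that `n
+ n l` consecutive windows, each made of `x̂(j)` and the next `n` outputs, are independent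
(`linearIndependent_dataMatrix_row`). They are added one at a time (`ae_linearIndependent_windows`).
Only the last output of a new window contains the newest measurement noise, a nondegenerate Gaussian
independent of everything earlier. Let `S` be the span of the earlier windows. If some noise
direction leaves `S`, the new window almost surely lies outside `S`. If all noise directions lie in
`S` and the new window does too, then `S` is invariant under the window shift, and closed-loop
controllability makes it the whole space (`span_window_eq_top`), which its dimension forbids. -/

theorem IsControllable.eq_zero_of_vecMul {A : Matrix (Fin n) (Fin n) ℝ}
    {B : Matrix (Fin n) (Fin m) ℝ} (h : IsControllable A B) {p : Fin n → ℝ}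
    (hp : ∀ k < n, p ᵥ* (A ^ k * B) = 0) : p = 0 := by
  have hrows : LinearIndependent ℝ (Matrix.of fun (i : Fin n) (p : Fin n × Fin m) =>
      (A ^ (p.1 : ℕ) * B) i p.2).row := by
    rw [linearIndependent_iff_card_eq_finrank_span, Set.finrank, ← rank_eq_finrank_span_row,
      Fintype.card_fin]
    exact h.symm
  refine vecMul_injective_iff.2 hrows ?_
  ext q
  have := congrFun (hp q.1 q.1.2) q.2
  simpa [vecMul, dotProduct] using this

theorem IsControllable.eq_top_of_mem {A : Matrix (Fin n) (Fin n) ℝ}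
    {B : Matrix (Fin n) (Fin m) ℝ} (h : IsControllable A B) {S : Submodule ℝ (Fin n → ℝ)}
    (hS : ∀ k y, A ^ k *ᵥ (B *ᵥ y) ∈ S) : S = ⊤ := by
  rw [IsControllable, rank_eq_finrank_span_cols] at h
  have htop := Submodule.eq_top_of_finrank_eq (h.trans (Module.finrank_fin_fun ℝ).symm)
  rw [eq_top_iff, ← htop, Submodule.span_le]
  rintro _ ⟨q, rfl⟩
  convert hS q.1 (Pi.single q.2 1) using 1
  rw [mulVec_mulVec, mulVec_single_one]
  rfl

theorem IsObservable.eq_zero_of_mulVec {A : Matrix (Fin n) (Fin n) ℝ}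
    {C : Matrix (Fin l) (Fin n) ℝ} (h : IsObservable A C) {x : Fin n → ℝ}
    (hx : ∀ k < n, C *ᵥ (A ^ k *ᵥ x) = 0) : x = 0 := by
  have hcols : LinearIndependent ℝ (Matrix.of fun (p : Fin n × Fin l) (j : Fin n) =>
      (C * A ^ (p.1 : ℕ)) p.2 j).col := by
    rw [linearIndependent_iff_card_eq_finrank_span, Set.finrank, ← rank_eq_finrank_span_cols,
      Fintype.card_fin]
    exact h.symm
  refine mulVec_injective_iff.2 hcols ?_
  ext q
  have := congrFun (hx q.1 q.1.2) q.2
  rw [mulVec_mulVec] at this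
  simpa [mulVec, dotProduct] using this

end Rank

/-! ### Pseudoinverses, kernels and row spaces. -/

section Matrices

variable {p q r : Type*} [Fintype p] [Fintype q]

/-- Independent rows allow `M` to be cancelled on the right in the Penrose identity `M M† M = M`. -/
theorem mul_pinv_eq_one [DecidableEq p] {M : Matrix p q ℝ} (h : LinearIndependent ℝ M.row) :
    M * pinv M = 1 := by
  have hM := (exists_isMoorePenrose M).choose_spec.mul_mul_left
  refine funext fun i => vecMul_injective_iff.2 h ?_
  change (M * pinv M * M) i = ((1 : Matrix p p ℝ) * M) i
  rw [Matrix.one_mul]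
  exact congrFun hM i

theorem mem_matKer {M : Matrix r q ℝ} {z : q → ℝ} : z ∈ matKer M ↔ M *ᵥ z = 0 := by
  simp [matKer]

/-- The row space of a matrix is the orthogonal complement of its kernel. -/
theorem mem_span_row_iff {M : Matrix r q ℝ} {z : q → ℝ} :
    z ∈ Submodule.span ℝ (Set.range M.row) ↔ ∀ s ∈ matKer M, z ⬝ᵥ s = 0 := by
  classical
  refine ⟨fun hz s hs => ?_, fun hz => ?_⟩
  · induction hz using Submodule.span_induction with
    | mem x hx =>
      obtain ⟨i, rfl⟩ := hx
      exact congrFun (mem_matKer.1 hs) i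
    | zero => simp
    | add x y _ _ hx hy => rw [add_dotProduct, hx, hy, add_zero]
    | smul c x _ hx => rw [smul_dotProduct, hx, smul_zero]
  · by_contra hzM
    -- A functional that kills the rows but not `z` is the dot product with a kernel vector,
    -- contradicting `hz`.
    obtain ⟨f, hfz, hf⟩ := Submodule.exists_le_ker_of_notMem hzM
    have hdot (x : q → ℝ) : f x = x ⬝ᵥ fun j => f (Pi.single j 1) := by
      conv_lhs => rw [pi_eq_sum_univ' x, map_sum]
      refine Finset.sum_congr rfl fun j _ => ?_
      rw [map_smul, smul_eq_mul]
    refine hfz ?_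
    rw [hdot]
    refine hz _ (mem_matKer.2 ?_)
    ext i
    have := hf (Submodule.subset_span (Set.mem_range_self i))
    rwa [LinearMap.mem_ker, hdot] at this

theorem rowsBasisOrthogonal_matKer {M : Matrix r q ℝ} (h : LinearIndependent ℝ M.row) :
    RowsBasisOrthogonal M (matKer M) :=
  ⟨h, fun _ => mem_span_row_iff⟩

theorem RowsBasisOrthogonal.exists_isUnit_mul [DecidableEq p] {M N : Matrix p q ℝ}
    {S : Submodule ℝ (q → ℝ)} (hM : RowsBasisOrthogonal M S) (hN : RowsBasisOrthogonal N S) :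
    ∃ P : Matrix p p ℝ, IsUnit P ∧ M = P * N := by
  have hrow (i : p) : ∃ c : p → ℝ, c ᵥ* N = M i := by
    have h : M.row i ∈ Submodule.span ℝ (Set.range N.row) :=
      (hN.2 _).2 ((hM.2 _).1 (Submodule.subset_span ⟨i, rfl⟩))
    rw [← range_vecMulLinear] at h
    exact h
  choose P hP using hrow
  have hMP : M = Matrix.of P * N := by
    exact funext fun i => (hP i).symm
  refine ⟨Matrix.of P, ?_, hMP⟩
  -- `P` inherits injectivity of left multiplication from `M = P * N`.
  rw [← linearIndependent_rows_iff_isUnit, ← vecMul_injective_iff]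
  intro c d hcd
  refine vecMul_injective_iff.2 hM.1 ?_
  simp only at hcd ⊢
  rw [hMP, ← vecMul_vecMul, ← vecMul_vecMul, hcd]

end Matrices

/-! ### The action and the row rank of the estimation matrix. -/

section EstimationMatrix

variable {n m l : ℕ} {E : Matrix (Fin n) (Fin n) ℝ} {F : Matrix (Fin n) (Fin m) ℝ}
  {G : Matrix (Fin n) (Fin l) ℝ} {a : Fin n → ℝ}

theorem rowKron_mulVec (k : ℕ) (x : Fin n × Fin k → ℝ) (i : Fin k) :
    (rowKron a k *ᵥ x) i = ∑ r, a r * x (r, i) := by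
  simp [rowKron, mulVec, dotProduct, Fintype.sum_prod_type, one_apply]

theorem toeplitz_mulVec (x : Fin n × Fin m → ℝ) (r i : Fin n) :
    (toeplitz E F *ᵥ x) (r, i) = (∑ s ∈ Finset.univ.filter (· < r),
      E ^ ((r : ℕ) - s - 1) *ᵥ (F *ᵥ fun j => x (s, j))) i := by
  rw [Finset.sum_apply, Finset.sum_filter, mulVec, dotProduct, Fintype.sum_prod_type]
  refine Finset.sum_congr rfl fun s _ => ?_
  split_ifs with h
  · rw [mulVec_mulVec]
    simp [toeplitz, h, mulVec, dotProduct]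
  · simp [toeplitz, h]

theorem reachRow_mulVec (x : Fin n × Fin m → ℝ) (i : Fin n) :
    (reachRow E F *ᵥ x) i = (∑ s : Fin n,
      E ^ (n - 1 - (s : ℕ)) *ᵥ (F *ᵥ fun j => x (s, j))) i := by
  rw [Finset.sum_apply, mulVec, dotProduct, Fintype.sum_prod_type]
  refine Finset.sum_congr rfl fun s _ => ?_
  rw [mulVec_mulVec]
  simp [reachRow, mulVec, dotProduct]

/-- The states of `x(k+1) = E x(k) + b(k)` in terms of the initial state and the inputs. -/
theorem state_eq_sum {x b : ℕ → Fin n → ℝ} (hx : ∀ k, x (k + 1) = E *ᵥ x k + b k) (k : ℕ) :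
    x k = E ^ k *ᵥ x 0 + ∑ s ∈ Finset.range k, E ^ (k - s - 1) *ᵥ b s := by
  induction k with
  | zero => simp
  | succ k ih =>
    rw [hx, ih, mulVec_add, mulVec_mulVec, ← pow_succ', Finset.sum_range_succ, mulVec_sum,
      add_assoc]
    congr 2
    · refine Finset.sum_congr rfl fun s hs => ?_
      have : k + 1 - s - 1 = k - s - 1 + 1 := by have := Finset.mem_range.1 hs; omega
      rw [mulVec_mulVec, ← pow_succ', this]
    · simp

/-- Expanding each state by `state_eq_sum`, the terms in `x 0` cancel because `E` satisfies the
relation with coefficients `a`. What remains depends on the inputs and outputs alone. -/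
theorem estimationMatrix_mulVec_inl (ha : E ^ n = ∑ k : Fin n, a k • E ^ (k : ℕ))
    {x : ℕ → Fin n → ℝ} {u : ℕ → Fin m → ℝ} {y : ℕ → Fin l → ℝ}
    (hx : ∀ k, x (k + 1) = E *ᵥ x k + (F *ᵥ u k + G *ᵥ y k)) (i : Fin n) :
    (estimationMatrix E F G a *ᵥ Sum.elim (fun q : Fin n × Fin m => u q.1 q.2)
      (fun q : Fin n × Fin l => y q.1 q.2)) (Sum.inl i) = (x n - ∑ k : Fin n, a k • x k) i := by
  have hn := state_eq_sum hx n
  have hk (k : Fin n) : x k = E ^ (k : ℕ) *ᵥ x 0 + ∑ s ∈ Finset.univ.filter (· < k),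
      E ^ ((k : ℕ) - s - 1) *ᵥ (F *ᵥ u s + G *ᵥ y s) := by
    rw [state_eq_sum hx k]
    congr 1
    refine (Finset.sum_bij (fun (s : Fin n) _ => (s : ℕ)) ?_ ?_ ?_ ?_).symm
    · intro s hs; simpa using hs
    · intro s _ s' _ h; exact Fin.ext h
    · intro s hs
      have hs := Finset.mem_range.1 hs
      exact ⟨⟨s, hs.trans k.2⟩, Finset.mem_filter.2 ⟨Finset.mem_univ _, hs⟩, rfl⟩
    · intros; rfl
  have h0 : E ^ n *ᵥ x 0 = ∑ k : Fin n, a k • (E ^ (k : ℕ) *ᵥ x 0) := by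
    rw [ha, sum_mulVec]
    simp only [smul_mulVec]
  rw [hn, h0]
  simp_rw [hk, smul_add, Finset.sum_add_distrib]
  rw [add_sub_add_left_eq_sub, Finset.sum_range]
  rw [estimationMatrix, fromBlocks_mulVec]
  simp only [Sum.elim_inl, Sum.elim_comp_inl, Sum.elim_comp_inr, Pi.add_apply, sub_mulVec,
    Pi.sub_apply, ← mulVec_mulVec, rowKron_mulVec, toeplitz_mulVec, reachRow_mulVec, mulVec_add,
    Finset.sum_add_distrib, smul_add, Finset.sum_apply, Pi.smul_apply, smul_eq_mul]
  have hp (s : Fin n) : n - (s : ℕ) - 1 = n - 1 - s := by omega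
  simp only [hp]
  ring

theorem estimationMatrix_mulVec_inr (u : ℕ → Fin m → ℝ) (y : ℕ → Fin l → ℝ) (i : Fin m) :
    (estimationMatrix E F G a *ᵥ Sum.elim (fun q : Fin n × Fin m => u q.1 q.2)
      (fun q : Fin n × Fin l => y q.1 q.2)) (Sum.inr i) = (∑ k : Fin n, a k • u k) i := by
  rw [estimationMatrix, fromBlocks_mulVec]
  simp [rowKron_mulVec]

theorem vecMul_estimationMatrix_inr (v : Fin n ⊕ Fin m → ℝ) (s : Fin n) (j : Fin l) :
    (v ᵥ* estimationMatrix E F G a) (Sum.inr (s, j)) =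
      ((fun i => v (Sum.inl i)) ᵥ* (E ^ (n - 1 - (s : ℕ)) * G)) j -
        ∑ r, a r * if s < r then
          ((fun i => v (Sum.inl i)) ᵥ* (E ^ ((r : ℕ) - s - 1) * G)) j else 0 := by
  have hprod (i : Fin n) : (rowKron a n * toeplitz E G) i (s, j) =
      ∑ r, a r * toeplitz E G (r, i) (s, j) :=
    rowKron_mulVec n (fun p => toeplitz E G p (s, j)) i
  have hsum (r : Fin n) : a r * (if s < r then
      ((fun i => v (Sum.inl i)) ᵥ* (E ^ ((r : ℕ) - s - 1) * G)) j else 0) =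
      ∑ i, v (Sum.inl i) * (a r * toeplitz E G (r, i) (s, j)) := by
    split_ifs with h
    · simp [vecMul, dotProduct, toeplitz, h, Finset.mul_sum, mul_left_comm]
    · simp [toeplitz, h]
  simp only [hsum]
  rw [Finset.sum_comm]
  simp [vecMul, dotProduct, estimationMatrix, hprod, reachRow, mul_sub, Finset.mul_sum]

/-- In a row relation, the output blocks read from last to first show that the upper part
annihilates `G`, `E G`, `E² G`, and so on. Controllability kills that part, and a nonzero entry of
`a` kills the rest. -/
theorem linearIndependent_row_estimationMatrix (hEG : IsControllable E G) (ha : a ≠ 0) :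
    LinearIndependent ℝ (estimationMatrix E F G a).row := by
  rw [← vecMul_injective_iff]
  refine (injective_iff_map_eq_zero (estimationMatrix E F G a).vecMulLinear).2 fun v hv => ?_
  have hv' (q) : (v ᵥ* estimationMatrix E F G a) q = 0 := congrFun hv q
  have hl : (fun i => v (Sum.inl i)) = 0 := by
    refine hEG.eq_zero_of_vecMul fun k => ?_
    induction k using Nat.strong_induction_on with
    | _ k ih =>
      intro hk
      ext j
      -- Block `n - 1 - k` has leading term `E ^ k * G`; its Toeplitz corrections involve only
      -- powers below `k`, covered by `ih`.
      have h := hv' (Sum.inr (⟨n - 1 - k, by omega⟩, j))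
      rw [vecMul_estimationMatrix_inr, Finset.sum_eq_zero, sub_zero] at h
      · have hk' : n - 1 - (n - 1 - k) = k := by omega
        simpa only [hk', Pi.zero_apply] using h
      · intro r _
        split_ifs with hr
        · have hr' : n - 1 - k < (r : ℕ) := hr
          rw [ih _ (by simp only; omega) (by simp only; omega), Pi.zero_apply, mul_zero]
        · rw [mul_zero]
  obtain ⟨s, hs⟩ := Function.ne_iff.1 ha
  ext (i | j)
  · exact congrFun hl i
  · have h := hv' (Sum.inl (s, j))
    have hl' (i) : v (Sum.inl i) = 0 := congrFun hl i
    have hs' : a s ≠ 0 := hs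
    simpa [vecMul, dotProduct, estimationMatrix, hl', rowKron, one_apply, hs'] using h

end EstimationMatrix

/-! ### Deterministic window dynamics and the rank of the data matrix. -/

section Window

variable {n l : ℕ}

/-- One step of the system whose state consists of the state of `x(t+1) = M x(t) + G y(t+1)` and
the next `n` values of `y`, without the value of `y` that enters the window. -/
def windowShift (M : Matrix (Fin n) (Fin n) ℝ) (G : Matrix (Fin n) (Fin l) ℝ) (hn : 0 < n) :
    (Fin n → ℝ) × (Fin n → Fin l → ℝ) →ₗ[ℝ] (Fin n → ℝ) × (Fin n → Fin l → ℝ) where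
  toFun z := (M *ᵥ z.1 + G *ᵥ z.2 ⟨0, hn⟩,
    fun k => if h : (k : ℕ) + 1 < n then z.2 ⟨k + 1, h⟩ else 0)
  map_add' z z' := by
    refine Prod.ext ?_ (funext fun k => ?_)
    · simp only [Prod.fst_add, Prod.snd_add, Pi.add_apply, mulVec_add]
      abel
    · by_cases h : (k : ℕ) + 1 < n <;> simp [h]
  map_smul' c z := by
    refine Prod.ext ?_ (funext fun k => ?_)
    · simp [mulVec_smul]
    · by_cases h : (k : ℕ) + 1 < n <;> simp [h]

/-- The window whose only nonzero entry is `y`, at position `k`. -/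
def windowSingle (k : Fin n) : (Fin l → ℝ) →ₗ[ℝ] (Fin n → ℝ) × (Fin n → Fin l → ℝ) :=
  LinearMap.inr ℝ _ _ ∘ₗ LinearMap.single ℝ (fun _ => Fin l → ℝ) k

/-- Shifting moves an output in the last slot to every earlier slot. From slot `0` it enters the
state through `G`, and further shifts apply powers of `M`, so controllability supplies all states.
-/
theorem eq_top_of_windowShift_mem {M : Matrix (Fin n) (Fin n) ℝ} {G : Matrix (Fin n) (Fin l) ℝ}
    (hMG : IsControllable M G) (hn : 0 < n)
    {S : Submodule ℝ ((Fin n → ℝ) × (Fin n → Fin l → ℝ))}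
    (hshift : ∀ z ∈ S, windowShift M G hn z ∈ S)
    (hsingle : ∀ y, windowSingle ⟨n - 1, by omega⟩ y ∈ S) : S = ⊤ := by
  have hall (d : ℕ) (hd : d < n) (y : Fin l → ℝ) : windowSingle ⟨n - 1 - d, by omega⟩ y ∈ S := by
    induction d with
    | zero => exact hsingle y
    | succ d ih =>
      convert hshift _ (ih (by omega)) using 1
      refine Prod.ext ?_ (funext fun k => ?_)
      · have : (⟨0, hn⟩ : Fin n) ≠ ⟨n - 1 - d, by omega⟩ := by
          rw [Ne, Fin.mk.injEq]; omega
        simp [windowSingle, windowShift, Pi.single_eq_of_ne this]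
      · simp only [windowSingle, windowShift, LinearMap.comp_apply, LinearMap.inr_apply,
          LinearMap.single_apply, LinearMap.coe_mk, AddHom.coe_mk, Pi.single_apply, Fin.ext_iff]
        split_ifs <;> first | rfl | omega
  have hstate : S.comap (LinearMap.inl ℝ (Fin n → ℝ) (Fin n → Fin l → ℝ)) = ⊤ := by
    refine hMG.eq_top_of_mem fun k y => ?_
    rw [Submodule.mem_comap]
    induction k with
    | zero =>
      have h := hshift _ (hall (n - 1) (by omega) y)
      have h0 : (⟨n - 1 - (n - 1), by omega⟩ : Fin n) = ⟨0, hn⟩ := by simp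
      rw [h0] at h
      convert h using 1
      refine Prod.ext ?_ (funext fun k => ?_)
      · simp [windowSingle, windowShift]
      · simp [windowSingle, windowShift, Fin.ext_iff]
    | succ k ih =>
      convert hshift _ ih using 1
      refine Prod.ext ?_ (funext fun k => ?_)
      · simp [windowShift, pow_succ', mulVec_mulVec, Matrix.mul_assoc]
      · simp [windowShift]
  refine eq_top_iff.2 fun z _ => ?_
  have hz : z = LinearMap.inl ℝ _ _ z.1 + ∑ k, windowSingle k (z.2 k) := by
    simp only [windowSingle, LinearMap.comp_apply, ← map_sum, LinearMap.single_apply,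
      Finset.univ_sum_single]
    simp
  rw [hz]
  refine S.add_mem (show z.1 ∈ S.comap _ from hstate ▸ trivial) (S.sum_mem fun k _ => ?_)
  have h := hall (n - 1 - k) (by omega) (z.2 k)
  have hk : (⟨n - 1 - (n - 1 - k), by omega⟩ : Fin n) = k := by ext; simp only; omega
  rwa [hk] at h

/-- The window at time `j` of a trajectory. -/
def window (x : ℕ → Fin n → ℝ) (y : ℕ → Fin l → ℝ) (j : ℕ) :
    (Fin n → ℝ) × (Fin n → Fin l → ℝ) :=
  (x j, fun k => y (j + 1 + k))

theorem window_succ {M : Matrix (Fin n) (Fin n) ℝ} {G : Matrix (Fin n) (Fin l) ℝ} (hn : 0 < n)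
    {x : ℕ → Fin n → ℝ} {y : ℕ → Fin l → ℝ} (hx : ∀ k, x (k + 1) = M *ᵥ x k + G *ᵥ y (k + 1))
    (j : ℕ) : window x y (j + 1) =
      windowShift M G hn (window x y j) + windowSingle ⟨n - 1, by omega⟩ (y (j + 1 + n)) := by
  refine Prod.ext ?_ (funext fun k => ?_)
  · simp [window, windowShift, windowSingle, hx]
  · simp only [window, windowShift, windowSingle, LinearMap.comp_apply, LinearMap.inr_apply,
      LinearMap.single_apply, LinearMap.coe_mk, AddHom.coe_mk, Pi.single_apply, Fin.ext_iff,
      Prod.snd_add, Pi.add_apply]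
    have hk := k.2
    split_ifs with h1 h2 h2
    · omega
    · rw [add_zero]; congr 1; omega
    · rw [zero_add]; congr 1; omega
    · omega

/-- The shift of a window is the next window minus a vector supported in the last slot, so the two
membership hypotheses make the span shift-invariant. -/
theorem span_window_eq_top {M : Matrix (Fin n) (Fin n) ℝ} {G : Matrix (Fin n) (Fin l) ℝ}
    (hMG : IsControllable M G) (hn : 0 < n) {x : ℕ → Fin n → ℝ} {y : ℕ → Fin l → ℝ}
    (hx : ∀ k, x (k + 1) = M *ᵥ x k + G *ᵥ y (k + 1)) {t j : ℕ}
    (hsingle : ∀ e, windowSingle ⟨n - 1, by omega⟩ e ∈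
      Submodule.span ℝ (Set.range fun i : Fin j => window x y (t + i)))
    (hj : window x y (t + j) ∈
      Submodule.span ℝ (Set.range fun i : Fin j => window x y (t + i))) :
    Submodule.span ℝ (Set.range fun i : Fin j => window x y (t + i)) = ⊤ := by
  refine eq_top_of_windowShift_mem hMG hn (fun z hz => ?_) hsingle
  induction hz using Submodule.span_induction with
  | mem z hz =>
    obtain ⟨i, rfl⟩ := hz
    have h := window_succ hn hx (t + i)
    rw [← sub_eq_iff_eq_add] at h
    simp only [← h]
    refine Submodule.sub_mem _ ?_ (hsingle _)
    -- Only the last of the `j` windows has its successor outside the family; `hj` covers it.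
    obtain hi | hi := (Nat.succ_le_of_lt i.2).lt_or_eq
    · exact Submodule.subset_span ⟨⟨i + 1, hi⟩, rfl⟩
    · rwa [add_assoc, ← Nat.succ_eq_add_one (i : ℕ), hi]
  | zero => rw [map_zero]; exact Submodule.zero_mem _
  | add z z' _ _ h h' => rw [map_add]; exact Submodule.add_mem _ h h'
  | smul c z _ h => rw [map_smul]; exact Submodule.smul_mem _ c h

/-- If a combination of columns vanishes, the same combination `z` of states evolves freely as `E ^
k z`, with `K E ^ k z = 0` for `k < n`. Observability gives `z = 0`, so the combination of windows
vanishes too. -/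
theorem linearIndependent_dataMatrix_row {E : Matrix (Fin n) (Fin n) ℝ}
    {F : Matrix (Fin n) (Fin 1) ℝ} {G : Matrix (Fin n) (Fin l) ℝ} {K : Matrix (Fin 1) (Fin n) ℝ}
    (hEK : IsObservable E K) {x : ℕ → Fin n → ℝ} {u : ℕ → Fin 1 → ℝ} {y : ℕ → Fin l → ℝ}
    (hx : ∀ k, x (k + 1) = E *ᵥ x k + F *ᵥ u k + G *ᵥ y (k + 1)) (hu : ∀ k, u k = K *ᵥ x k)
    {t c : ℕ} (hc : n + n * l ≤ c)
    (h : LinearIndependent ℝ fun i : Fin (n + n * l) => window x y (t + i)) :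
    LinearIndependent ℝ (dataMatrix u y t n c).row := by
  have hcol : LinearIndependent ℝ
      fun i : Fin (n + n * l) => (dataMatrix u y t n c).col (Fin.castLE hc i) := by
    rw [Fintype.linearIndependent_iff] at h ⊢
    intro g hg
    refine h g ?_
    have hU (k : ℕ) (hk : k < n) : ∑ i, g i • u (t + i + k) = 0 := by
      ext s
      simpa [dataMatrix] using congrFun hg (Sum.inl (⟨k, hk⟩, s))
    have hY (k : ℕ) (hk : k < n) : ∑ i, g i • y (t + i + 1 + k) = 0 := by
      ext s
      have := congrFun hg (Sum.inr (⟨k, hk⟩, s))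
      simpa [dataMatrix, add_right_comm] using this
    have hX (k : ℕ) (hk : k ≤ n) : ∑ i, g i • x (t + i + k) = E ^ k *ᵥ ∑ i, g i • x (t + i) := by
      induction k with
      | zero => simp
      | succ k ih =>
        have hstep : ∑ i, g i • x (t + i + (k + 1)) = E *ᵥ (∑ i, g i • x (t + i + k)) +
            F *ᵥ (∑ i, g i • u (t + i + k)) + G *ᵥ (∑ i, g i • y (t + i + 1 + k)) := by
          simp only [mulVec_sum, mulVec_smul, ← Finset.sum_add_distrib, ← smul_add]
          refine Finset.sum_congr rfl fun i _ => ?_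
          rw [← add_assoc, hx, add_right_comm (t + (i : ℕ)) k 1]
        rw [hstep, hU k hk, hY k hk, ih (by omega), mulVec_zero, mulVec_zero, add_zero, add_zero,
          mulVec_mulVec, ← pow_succ']
    have h0 : ∑ i, g i • x (t + i) = 0 := by
      refine hEK.eq_zero_of_mulVec fun k hk => ?_
      rw [← hX k hk.le, ← hU k hk]
      simp only [mulVec_sum, mulVec_smul, hu]
    refine Prod.ext ?_ (funext fun k => ?_)
    · simpa [window, Prod.fst_sum] using h0
    · simpa [window, Prod.snd_sum] using hY k k.2
  -- With a single input a column has exactly `n + n * l` entries, so these columns span.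
  have htop := hcol.span_eq_top_of_card_eq_finrank' (by simp)
  rw [← vecMul_injective_iff]
  refine (injective_iff_map_eq_zero (dataMatrix u y t n c).vecMulLinear).2 fun v hv => ?_
  have hker : ∀ z : (Fin n × Fin 1) ⊕ (Fin n × Fin l) → ℝ, v ⬝ᵥ z = 0 := by
    intro z
    have hz : z ∈ (⊤ : Submodule ℝ ((Fin n × Fin 1) ⊕ (Fin n × Fin l) → ℝ)) := trivial
    rw [← htop] at hz
    induction hz using Submodule.span_induction with
    | mem z hz =>
      obtain ⟨i, rfl⟩ := hz
      exact congrFun hv (Fin.castLE hc i)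
    | zero => simp
    | add z z' _ _ h h' => rw [dotProduct_add, h, h', add_zero]
    | smul c z _ h => rw [dotProduct_smul, h, smul_zero]
  exact dotProduct_eq_zero v hker

/-- The recorded inputs satisfy `Ū = [K 1] L_est H`. -/
theorem inputRow_eq {E : Matrix (Fin n) (Fin n) ℝ} {F : Matrix (Fin n) (Fin 1) ℝ}
    {G : Matrix (Fin n) (Fin l) ℝ} {K : Matrix (Fin 1) (Fin n) ℝ} {a : Fin n → ℝ}
    (ha : E ^ n = ∑ k : Fin n, a k • E ^ (k : ℕ))
    {x : ℕ → Fin n → ℝ} {u : ℕ → Fin 1 → ℝ} {y : ℕ → Fin l → ℝ}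
    (hx : ∀ k, x (k + 1) = E *ᵥ x k + F *ᵥ u k + G *ᵥ y (k + 1)) (hu : ∀ k, u k = K *ᵥ x k)
    (t c : ℕ) :
    inputRow u t n c = Matrix.fromCols K (1 : Matrix (Fin 1) (Fin 1) ℝ) *
      estimationMatrix E F G a * dataMatrix u y t n c := by
  ext s j
  have hx' (k : ℕ) : x (t + j + (k + 1)) =
      E *ᵥ x (t + j + k) + (F *ᵥ u (t + j + k) + G *ᵥ y (t + 1 + j + k)) := by
    rw [← add_assoc, hx, add_assoc (E *ᵥ _)]
    congr 4
    omega
  have hl := estimationMatrix_mulVec_inl ha (x := fun k => x (t + j + k))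
    (u := fun k => u (t + j + k)) (y := fun k => y (t + 1 + j + k)) hx'
  have hr := estimationMatrix_mulVec_inr (E := E) (F := F) (G := G) (a := a)
    (fun k => u (t + j + k)) (fun k => y (t + 1 + j + k))
  have hcol : (estimationMatrix E F G a *ᵥ (dataMatrix u y t n c).col j) =
      Sum.elim (x (t + j + n) - ∑ k : Fin n, a k • x (t + j + k))
        (∑ k : Fin n, a k • u (t + j + k)) := by
    ext (i | i)
    · exact hl i
    · exact hr i
  rw [Matrix.mul_assoc]
  change u (t + n + j) s = (Matrix.fromCols K (1 : Matrix (Fin 1) (Fin 1) ℝ) *ᵥ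
    (estimationMatrix E F G a *ᵥ (dataMatrix u y t n c).col j)) s
  -- `K` turns the states into inputs, so the two sums weighted by `a` cancel.
  rw [hcol, fromCols_mulVec_sumElim, one_mulVec, mulVec_sub, mulVec_sum]
  simp only [mulVec_smul, ← hu, sub_add_cancel, add_right_comm]

/-- If `a = 0`, then `E` is nilpotent and has a kernel vector `x ≠ 0`. As `1 - L C` is injective, `A
x = 0`. The LQR gain ends in the factor `A`, so `K x = 0` as well, against observability of `(E,
K)`. -/
theorem coeff_ne_zero {A : Matrix (Fin n) (Fin n) ℝ} {B : Matrix (Fin n) (Fin 1) ℝ}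
    {C : Matrix (Fin l) (Fin n) ℝ} {W Q : Matrix (Fin n) (Fin n) ℝ} {V : Matrix (Fin l) (Fin l) ℝ}
    {R : Matrix (Fin 1) (Fin 1) ℝ} {L : Matrix (Fin n) (Fin l) ℝ} {K : Matrix (Fin 1) (Fin n) ℝ}
    (hn : 0 < n) (hV : V.PosDef) (hL : IsKalmanGain A C W V L) (hK : IsLQRGain A B Q R K)
    (hEK : IsObservable (ctrlE A C L) K) {a : Fin n → ℝ}
    (ha : ctrlE A C L ^ n = ∑ k : Fin n, a k • ctrlE A C L ^ (k : ℕ)) : a ≠ 0 := by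
  rintro rfl
  obtain ⟨S, hS, -, hLS⟩ := hL
  obtain ⟨P, -, -, hKP⟩ := hK
  have hZ : (C * S * Cᵀ + V).PosDef := by
    have := hS.mul_mul_conjTranspose_same C
    rw [conjTranspose_eq_transpose_of_trivial] at this
    exact hV.posSemidef_add this
  have hinj {x : Fin n → ℝ} (hx : (1 - L * C) *ᵥ x = 0) : x = 0 := by
    have hCx : V *ᵥ ((C * S * Cᵀ + V)⁻¹ *ᵥ (C *ᵥ x)) = 0 := by
      -- With `Z = C S Cᵀ + V`, this identity gives `Z⁻¹ C x = 0`, hence `L C x = 0`, for every `x`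
      -- in the kernel of `1 - L C`.
      have h1 : C * (1 - L * C) = V * (C * S * Cᵀ + V)⁻¹ * C := by
        have h2 : V * (C * S * Cᵀ + V)⁻¹ = 1 - C * S * Cᵀ * (C * S * Cᵀ + V)⁻¹ := by
          rw [eq_sub_iff_add_eq, ← Matrix.add_mul, add_comm V,
            Matrix.mul_nonsing_inv _ ((Matrix.isUnit_iff_isUnit_det _).1 hZ.isUnit)]
        rw [h2, hLS]
        simp only [Matrix.mul_sub, Matrix.sub_mul, Matrix.mul_one, Matrix.one_mul,
          Matrix.mul_assoc]
      rw [mulVec_mulVec, mulVec_mulVec, ← h1, ← mulVec_mulVec, hx, mulVec_zero]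
    have hCx' : (C * S * Cᵀ + V)⁻¹ *ᵥ (C *ᵥ x) = 0 :=
      mulVec_injective_of_isUnit hV.isUnit (by simpa using hCx)
    have : L *ᵥ (C *ᵥ x) = 0 := by
      rw [hLS, ← mulVec_mulVec, hCx', mulVec_zero]
    rw [sub_mulVec, one_mulVec, ← mulVec_mulVec, this, sub_zero] at hx
    exact hx
  have hdet : (ctrlE A C L).det = 0 := by
    have h : (ctrlE A C L ^ n).det = 0 := by
      rw [ha]
      have : Nonempty (Fin n) := ⟨⟨0, hn⟩⟩
      simp
    rw [det_pow] at h
    exact eq_zero_of_pow_eq_zero h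
  obtain ⟨x, hx0, hx⟩ := exists_mulVec_eq_zero_iff.2 hdet
  have hAx : A *ᵥ x = 0 := hinj (by rw [mulVec_mulVec]; exact hx)
  refine hx0 (hEK.eq_zero_of_mulVec fun k _ => ?_)
  cases k with
  | zero =>
    rw [pow_zero, one_mulVec, hKP, neg_mulVec, ← mulVec_mulVec, ← mulVec_mulVec, hAx]
    simp
  | succ k => rw [pow_succ, ← mulVec_mulVec, hx, mulVec_zero, mulVec_zero]

end Window

/-! ### Gaussian null sets and independence. -/

section Noise

variable {Ω : Type*} {mΩ : MeasurableSpace Ω} {μ : Measure Ω} {l : ℕ}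

/-- The image under `f` is a real Gaussian whose variance is positive because `V` is positive
definite; it has no atoms. -/
theorem multivariateGaussian_hyperplane {V : Matrix (Fin l) (Fin l) ℝ} (hV : V.PosDef)
    (f : EuclideanSpace ℝ (Fin l) →ₗ[ℝ] ℝ) (hf : f ≠ 0) (c : ℝ) :
    multivariateGaussian 0 V {e | f e = c} = 0 := by
  set L : StrongDual ℝ (EuclideanSpace ℝ (Fin l)) := f.toContinuousLinearMap with hLf
  obtain ⟨b, hb⟩ : ∃ b, (InnerProductSpace.toDual ℝ (EuclideanSpace ℝ (Fin l))) b = L :=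
    (InnerProductSpace.toDual ℝ _).surjective L
  have hb0 : b ≠ 0 := by
    rintro rfl
    refine hf (LinearMap.ext fun e => ?_)
    have := congrArg (fun g => g e) hb
    simpa [hLf] using this.symm
  have hinner : (fun e => inner ℝ b e) = (L : EuclideanSpace ℝ (Fin l) → ℝ) := by
    ext e
    rw [← hb, InnerProductSpace.toDual_apply_apply]
  have hvar : 0 < Var[L; multivariateGaussian 0 V] := by
    rw [← hinner, ← covarianceBilin_self IsGaussian.memLp_two_id,
      covarianceBilin_multivariateGaussian hV.posSemidef]
    have hb' : b.ofLp ≠ 0 := fun h => hb0 (by ext i; exact congrFun h i)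
    simpa using hV.dotProduct_mulVec_pos hb'
  have hmap := IsGaussian.map_eq_gaussianReal (μ := multivariateGaussian 0 V) L
  have : NullSingletonClass (gaussianReal (∫ x, L x ∂multivariateGaussian 0 V)
      Var[L; multivariateGaussian 0 V].toNNReal) :=
    nullSingletonClass_gaussianReal (by simpa using hvar)
  have h0 := measure_singleton (μ := gaussianReal (∫ x, L x ∂multivariateGaussian 0 V)
      Var[L; multivariateGaussian 0 V].toNNReal) c
  rw [← hmap, Measure.map_apply L.continuous.measurable (measurableSet_singleton c)] at h0
  exact h0

theorem indepFun_prodMk_left [IsProbabilityMeasure μ] {α β γ : Type*}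
    [MeasurableSpace α] [MeasurableSpace β] [MeasurableSpace γ] {X : Ω → α} {Y : Ω → β} {Z : Ω → γ}
    (hX : AEMeasurable X μ)
    (hY : AEMeasurable Y μ) (hZ : AEMeasurable Z μ)
    (h : IndepFun X (fun ω => (Y ω, Z ω)) μ) (hYZ : IndepFun Y Z μ) :
    IndepFun (fun ω => (X ω, Y ω)) Z μ := by
  have hXY : IndepFun X Y μ := h.comp measurable_id measurable_fst
  rw [indepFun_iff_map_prod_eq_prod_map_map (hX.prodMk hY) hZ,
    (indepFun_iff_map_prod_eq_prod_map_map hX hY).1 hXY]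
  have h1 := (indepFun_iff_map_prod_eq_prod_map_map hX (hY.prodMk hZ)).1 h
  rw [(indepFun_iff_map_prod_eq_prod_map_map hY hZ).1 hYZ] at h1
  have := Measure.isProbabilityMeasure_map (μ := μ) hX
  have := Measure.isProbabilityMeasure_map (μ := μ) hY
  have := Measure.isProbabilityMeasure_map (μ := μ) hZ
  have h2 := congrArg (Measure.map MeasurableEquiv.prodAssoc.symm) h1
  rw [← Measure.prodAssoc_prod, MeasurableEquiv.map_symm_map] at h2
  rw [← h2, AEMeasurable.map_map_of_aemeasurable (by fun_prop) (hX.prodMk (hY.prodMk hZ))]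
  rfl

/-- Fubini: independence makes the joint law a product, and every relevant section is null. -/
theorem ae_notMem_of_indepFun [IsProbabilityMeasure μ] {α β : Type*}
    [MeasurableSpace α] [MeasurableSpace β] {X : Ω → α} {v : Ω → β} {ν : Measure β} [IsProbabilityMeasure ν]
    (hX : AEMeasurable X μ)
    (hv : HasLaw v ν μ) (hXv : IndepFun X v μ) {s : Set (α × β)} (hs : MeasurableSet s)
    (h : ∀ ω, ν {e | (X ω, e) ∈ s} = 0) : ∀ᵐ ω ∂μ, (X ω, v ω) ∉ s := by
  have hlaw := (indepFun_iff_map_prod_eq_prod_map_map hX hv.aemeasurable).1 hXv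
  rw [hv.map_eq] at hlaw
  have hnull : (μ.map X).prod ν s = 0 := by
    rw [Measure.measure_prod_null hs]
    refine (ae_map_iff hX (p := fun a => ν (Prod.mk a ⁻¹' s) = 0) ?_).2 (.of_forall h)
    exact measurable_measure_prodMk_left hs (measurableSet_singleton 0)
  rw [← hlaw] at hnull
  exact ae_of_ae_map (hX.prodMk hv.aemeasurable) (measure_eq_zero_iff_ae_notMem.1 hnull)

/-- With `X` fixed, the bad noise values lie in a proper affine hyperplane when `Γ` leaves the span.
Otherwise `h` says that there are none. -/
theorem ae_linearIndependent_snoc [IsProbabilityMeasure μ] {H : Type*}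
    [NormedAddCommGroup H] [NormedSpace ℝ H]
    [FiniteDimensional ℝ H] [MeasurableSpace H] [BorelSpace H]
    {V : Matrix (Fin l) (Fin l) ℝ} (hV : V.PosDef) {v : Ω → EuclideanSpace ℝ (Fin l)}
    (hv : HasLaw v (multivariateGaussian 0 V) μ) {j : ℕ} {X : Ω → (Fin j → H) × H}
    (hX : AEMeasurable X μ) (hXv : IndepFun X v μ) (Γ : EuclideanSpace ℝ (Fin l) →ₗ[ℝ] H)
    (h : ∀ ω, LinearIndependent ℝ (X ω).1 →
      LinearMap.range Γ ≤ Submodule.span ℝ (Set.range (X ω).1) →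
      ∀ e, (X ω).2 + Γ e ∉ Submodule.span ℝ (Set.range (X ω).1)) :
    ∀ᵐ ω ∂μ, LinearIndependent ℝ (X ω).1 →
      LinearIndependent ℝ (Fin.snoc (X ω).1 ((X ω).2 + Γ (v ω)) : Fin (j + 1) → H) := by
  have := FiniteDimensional.proper ℝ H
  have hΓ : Continuous Γ := Γ.continuous_of_finiteDimensional
  set s : Set (((Fin j → H) × H) × EuclideanSpace ℝ (Fin l)) :=
    {p | LinearIndependent ℝ p.1.1 ∧
      ¬ LinearIndependent ℝ (Fin.snoc p.1.1 (p.1.2 + Γ p.2) : Fin (j + 1) → H)} with hs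
  have hmeas : MeasurableSet s := by
    -- Linear independence of a finite family is an open condition, which gives measurability.
    refine MeasurableSet.inter ?_ (MeasurableSet.compl ?_)
    · exact (isOpen_setOfPred_linearIndependent.preimage
        (continuous_fst.comp continuous_fst)).measurableSet
    · refine (isOpen_setOfPred_linearIndependent.preimage (f := fun p :
        ((Fin j → H) × H) × EuclideanSpace ℝ (Fin l) =>
        (Fin.snoc p.1.1 (p.1.2 + Γ p.2) : Fin (j + 1) → H)) ?_).measurableSet
      fun_prop
  have key := ae_notMem_of_indepFun hX hv hXv hmeas fun ω => ?_
  · filter_upwards [key] with ω hω hli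
    by_contra hcon
    exact hω ⟨hli, hcon⟩
  by_cases hli : LinearIndependent ℝ (X ω).1
  swap
  · simp [hs, hli]
  have hsub : {e | (X ω, e) ∈ s} ⊆
      {e | (X ω).2 + Γ e ∈ Submodule.span ℝ (Set.range (X ω).1)} := by
    rintro e ⟨-, he⟩
    rw [linearIndependent_finSnoc] at he
    by_contra hcon
    exact he ⟨hli, hcon⟩
  refine measure_mono_null hsub ?_
  by_cases hr : LinearMap.range Γ ≤ Submodule.span ℝ (Set.range (X ω).1)
  · convert measure_empty (μ := multivariateGaussian 0 V)
    exact Set.eq_empty_of_forall_notMem (h ω hli hr)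
  · obtain ⟨_, ⟨e₀, rfl⟩, he₀⟩ := Set.not_subset.1 hr
    obtain ⟨f, hf0, hf⟩ := Submodule.exists_le_ker_of_notMem he₀
    refine measure_mono_null (fun e he => ?_)
      (multivariateGaussian_hyperplane hV (f ∘ₗ Γ) (fun h0 => hf0 ?_) (-f (X ω).2))
    · have := hf he
      rw [LinearMap.mem_ker, map_add] at this
      exact eq_neg_of_add_eq_zero_right this
    · exact LinearMap.congr_fun h0 e₀

end Noise

/-! ### Almost sure independence of the windows of a run. -/

theorem measurable_mulVec {Ω : Type*} {mΩ : MeasurableSpace Ω} {n m : ℕ}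
    (M : Matrix (Fin m) (Fin n) ℝ) {f : Ω → Fin n → ℝ} (hf : Measurable f) :
    Measurable fun ω => M *ᵥ f ω :=
  (M.mulVecLin.continuous_of_finiteDimensional.measurable).comp hf

namespace ExpertRun

variable {Ω : Type*} [mΩ : MeasurableSpace Ω] {μ : Measure Ω} {n l : ℕ}
  {A : Matrix (Fin n) (Fin n) ℝ} {B : Matrix (Fin n) (Fin 1) ℝ} {C : Matrix (Fin l) (Fin n) ℝ}
  {W : Matrix (Fin n) (Fin n) ℝ} {V : Matrix (Fin l) (Fin l) ℝ} {L : Matrix (Fin n) (Fin l) ℝ}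
  {K : Matrix (Fin 1) (Fin n) ℝ}

/-- The initial states, the process noise, and the measurement noise at times `1, …, s`. -/
def past (D : ExpertRun μ A B C W V L K) (s : ℕ) (ω : Ω) :
    ((Fin n → ℝ) × (Fin n → ℝ)) × (ℕ → EuclideanSpace ℝ (Fin n)) ×
      (Finset.range s → EuclideanSpace ℝ (Fin l)) :=
  ((D.x 0 ω, D.xhat 0 ω), fun t => D.w t ω, fun k => D.v (k + 1) ω)

theorem aemeasurable_past (D : ExpertRun μ A B C W V L K) (s : ℕ) : AEMeasurable (D.past s) μ :=
  (D.aemeasurable_x_zero.prodMk D.aemeasurable_xhat_zero).prodMk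
    ((aemeasurable_pi_lambda _ fun t => (D.law_w t).aemeasurable).prodMk
      (aemeasurable_pi_lambda _ fun k => (D.law_v (k + 1)).aemeasurable))

/-- The whole process noise sequence, future included, may be placed in the past: the argument needs
only the randomness of one fresh measurement noise. -/
theorem indepFun_past [IsProbabilityMeasure μ] (D : ExpertRun μ A B C W V L K) (s : ℕ) :
    IndepFun (D.past s) (D.v (s + 1)) μ := by
  have hw : AEMeasurable (fun ω t => D.w t ω) μ :=
    aemeasurable_pi_lambda _ fun t => (D.law_w t).aemeasurable
  have hv (k : ℕ) : AEMeasurable (D.v k) μ := (D.law_v k).aemeasurable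
  have hvs : AEMeasurable (fun ω (k : Finset.range s) => D.v (k + 1) ω) μ :=
    aemeasurable_pi_lambda _ fun k => hv _
  have h1 : IndepFun (fun ω (k : Finset.range s) => D.v (k + 1) ω) (D.v (s + 1)) μ := by
    have hinj : Function.Injective fun k : ℕ => k + 1 := add_left_injective 1
    have h := (D.indep_v.precomp hinj).indepFun_finset₀ (Finset.range s) {s} (by simp)
      fun k => hv (k + 1)
    exact h.comp measurable_id (measurable_pi_apply ⟨s, Finset.mem_singleton_self s⟩)
  have h2 : IndepFun (fun ω => ((fun t => D.w t ω), fun k : Finset.range s => D.v (k + 1) ω))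
      (D.v (s + 1)) μ := by
    refine indepFun_prodMk_left hw hvs (hv _) ?_ h1
    exact D.indep_w_v.comp measurable_id (ψ := fun f : ℕ → EuclideanSpace ℝ (Fin l) =>
      ((fun k : Finset.range s => f (k + 1)), f (s + 1))) (by fun_prop)
  refine indepFun_prodMk_left (D.aemeasurable_x_zero.prodMk D.aemeasurable_xhat_zero)
    (hw.prodMk hvs) (hv _) ?_ h2
  -- The noise in `indep_init` is already shifted by one, so index `s` stands for time `s + 1`.
  exact D.indep_init.comp measurable_id (ψ := fun f : (ℕ → EuclideanSpace ℝ (Fin n)) ×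
    (ℕ → EuclideanSpace ℝ (Fin l)) =>
      ((f.1, fun k : Finset.range s => f.2 k), f.2 s)) (by fun_prop)

/-- The information contained in `past`. -/
abbrev pastSpace (D : ExpertRun μ A B C W V L K) (s : ℕ) : MeasurableSpace Ω :=
  MeasurableSpace.comap (D.past s) inferInstance

theorem measurable_v_past (D : ExpertRun μ A B C W V L K) {s k : ℕ} (hk : k < s) :
    Measurable[D.pastSpace s] (D.v (k + 1)) := by
  have h : Measurable fun p : ((Fin n → ℝ) × (Fin n → ℝ)) × (ℕ → EuclideanSpace ℝ (Fin n)) ×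
      (Finset.range s → EuclideanSpace ℝ (Fin l)) => p.2.2 ⟨k, Finset.mem_range.2 hk⟩ := by
    fun_prop
  exact h.comp (comap_measurable (D.past s))

theorem measurable_w_past (D : ExpertRun μ A B C W V L K) (s t : ℕ) :
    Measurable[D.pastSpace s] (D.w t) := by
  have h : Measurable fun p : ((Fin n → ℝ) × (Fin n → ℝ)) × (ℕ → EuclideanSpace ℝ (Fin n)) ×
      (Finset.range s → EuclideanSpace ℝ (Fin l)) => p.2.1 t := by
    fun_prop
  exact h.comp (comap_measurable (D.past s))

/-- The plant state runs one step ahead of the estimate: `x (k + 1)` needs measurement noise only up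
to time `k`. -/
theorem measurable_state_past (D : ExpertRun μ A B C W V L K) {s k : ℕ} (hk : k ≤ s) :
    Measurable[D.pastSpace s] (D.x (k + 1)) ∧ Measurable[D.pastSpace s] (D.xhat k) := by
  have hw (t : ℕ) : Measurable[D.pastSpace s] fun ω => (D.w t ω).ofLp :=
    (WithLp.measurable_ofLp 2 _).comp (D.measurable_w_past s t)
  have hu {t : ℕ} (h : Measurable[D.pastSpace s] (D.xhat t)) :
      Measurable[D.pastSpace s] (D.u t) := by
    rw [funext (D.u_eq t)]
    exact measurable_mulVec K h
  have hx {t : ℕ} (h : Measurable[D.pastSpace s] (D.x t))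
      (h' : Measurable[D.pastSpace s] (D.xhat t)) : Measurable[D.pastSpace s] (D.x (t + 1)) := by
    rw [funext (D.x_succ t)]
    exact ((measurable_mulVec A h).add (measurable_mulVec B (hu h'))).add (hw t)
  induction k with
  | zero =>
    have hinit : Measurable[D.pastSpace s] (D.past s) := comap_measurable _
    have h : Measurable[D.pastSpace s] (D.xhat 0) :=
      (measurable_snd.comp measurable_fst).comp hinit
    exact ⟨hx ((measurable_fst.comp measurable_fst).comp hinit) h, h⟩
  | succ k ih =>
    obtain ⟨ihx, ihxhat⟩ := ih (by omega)
    have hy : Measurable[D.pastSpace s] (D.y (k + 1)) := by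
      rw [funext (D.y_eq (k + 1))]
      exact (measurable_mulVec C ihx).add
        ((WithLp.measurable_ofLp 2 _).comp (D.measurable_v_past hk))
    have hxhat : Measurable[D.pastSpace s] (D.xhat (k + 1)) := by
      rw [funext (D.xhat_succ k)]
      exact ((measurable_mulVec _ ihxhat).add (measurable_mulVec _ (hu ihxhat))).add
        (measurable_mulVec _ hy)
    exact ⟨hx ihx hxhat, hxhat⟩

theorem measurable_y_past (D : ExpertRun μ A B C W V L K) {s k : ℕ} (hk : k < s) :
    Measurable[D.pastSpace s] (D.y (k + 1)) := by
  rw [funext (D.y_eq (k + 1))]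
  exact (measurable_mulVec C (D.measurable_state_past hk.le).1).add
    ((WithLp.measurable_ofLp 2 _).comp (D.measurable_v_past hk))

/-- Such an `f` factors measurably through `past`, so it inherits independence of the next noise. -/
theorem indepFun_of_measurable_past [IsProbabilityMeasure μ] (D : ExpertRun μ A B C W V L K)
    {s : ℕ} {β : Type*} [MeasurableSpace β] [StandardBorelSpace β] [Nonempty β] {f : Ω → β}
    (hf : Measurable[D.pastSpace s] f) : AEMeasurable f μ ∧ IndepFun f (D.v (s + 1)) μ := by
  obtain ⟨g, hg, rfl⟩ := hf.exists_eq_measurable_comp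
  exact ⟨hg.comp_aemeasurable (D.aemeasurable_past s),
    (D.indepFun_past s).comp hg measurable_id⟩

theorem xhat_succ_closed (D : ExpertRun μ A B C W V L K) (k : ℕ) (ω : Ω) :
    D.xhat (k + 1) ω =
      (ctrlE A C L + ctrlF B C L * K) *ᵥ D.xhat k ω + L *ᵥ D.y (k + 1) ω := by
  rw [D.xhat_succ, D.u_eq, add_mulVec, mulVec_mulVec]

/-- The windows of a run. -/
def windows (D : ExpertRun μ A B C W V L K) (ω : Ω) (j : ℕ) :
    (Fin n → ℝ) × (Fin n → Fin l → ℝ) :=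
  window (fun k => D.xhat k ω) (fun k => D.y k ω) j

theorem measurable_windows (D : ExpertRun μ A B C W V L K) {s j : ℕ} (hj : j + n ≤ s) :
    Measurable[D.pastSpace s] fun ω => D.windows ω j := by
  refine ((D.measurable_state_past (by omega)).2).prodMk
    (@measurable_pi_lambda _ _ _ (D.pastSpace s) _ _ fun k => ?_)
  have := D.measurable_y_past (s := s) (k := j + k) (by omega)
  simpa only [add_right_comm] using this

/-- The part of the window at time `j` that is determined before the last measurement noise in
it. -/
def predictedWindow (D : ExpertRun μ A B C W V L K) (ω : Ω) (j : ℕ) :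
    (Fin n → ℝ) × (Fin n → Fin l → ℝ) :=
  (D.xhat j ω, fun k => if (k : ℕ) + 1 = n then C *ᵥ D.x (j + n) ω else D.y (j + 1 + k) ω)

theorem measurable_predictedWindow (D : ExpertRun μ A B C W V L K) {s j : ℕ}
    (hj : j + n = s + 1) (hn : 0 < n) :
    Measurable[D.pastSpace s] fun ω => D.predictedWindow ω j := by
  refine ((D.measurable_state_past (by omega)).2).prodMk
    (@measurable_pi_lambda _ _ _ (D.pastSpace s) _ _ fun k => ?_)
  split_ifs with hk
  · rw [hj]
    exact measurable_mulVec C (D.measurable_state_past le_rfl).1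
  · have := D.measurable_y_past (s := s) (k := j + k) (by omega)
    simpa only [add_right_comm] using this

/-- The effect of the last measurement noise on a window. -/
def noiseWindow (l : ℕ) (hn : 0 < n) :
    EuclideanSpace ℝ (Fin l) →ₗ[ℝ] (Fin n → ℝ) × (Fin n → Fin l → ℝ) :=
  windowSingle ⟨n - 1, by omega⟩ ∘ₗ (WithLp.linearEquiv 2 ℝ (Fin l → ℝ)).toLinearMap

theorem windows_eq_add (D : ExpertRun μ A B C W V L K) (hn : 0 < n) (ω : Ω) (j : ℕ) :
    D.windows ω j = D.predictedWindow ω j + noiseWindow l hn (D.v (j + n) ω) := by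
  refine Prod.ext ?_ (funext fun k => ?_)
  · simp [windows, window, predictedWindow, noiseWindow, windowSingle]
  · simp only [windows, window, predictedWindow, noiseWindow, windowSingle, LinearMap.comp_apply,
      LinearMap.inr_apply, LinearMap.single_apply, Pi.single_apply, Fin.ext_iff, Prod.snd_add,
      Pi.add_apply]
    have hk := k.2
    split_ifs with h1 h2 h2
    · have : j + 1 + (k : ℕ) = j + n := by omega
      rw [this, D.y_eq]
      rfl
    · omega
    · omega
    · rw [add_zero]

theorem span_windows_eq_top (D : ExpertRun μ A B C W V L K) (hn : 0 < n)
    (hc : IsControllable (ctrlE A C L + ctrlF B C L * K) L) {ω : Ω} {t j : ℕ}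
    (hnoise : ∀ e, noiseWindow l hn e ∈
      Submodule.span ℝ (Set.range fun i : Fin j => D.windows ω (t + i)))
    (hj : D.windows ω (t + j) ∈
      Submodule.span ℝ (Set.range fun i : Fin j => D.windows ω (t + i))) :
    Submodule.span ℝ (Set.range fun i : Fin j => D.windows ω (t + i)) = ⊤ :=
  span_window_eq_top (x := fun k => D.xhat k ω) (y := fun k => D.y k ω) hc hn
    (fun k => D.xhat_succ_closed k ω) (fun y => hnoise (WithLp.toLp 2 y)) hj

theorem ae_linearIndependent_windows [IsProbabilityMeasure μ] (D : ExpertRun μ A B C W V L K)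
    (hV : V.PosDef) (hn : 0 < n)
    (hc : IsControllable (ctrlE A C L + ctrlF B C L * K) L) (t : ℕ) {j : ℕ}
    (hj : j ≤ n + n * l) :
    ∀ᵐ ω ∂μ, LinearIndependent ℝ fun i : Fin j => D.windows ω (t + i) := by
  induction j with
  | zero => exact .of_forall fun ω => linearIndependent_empty_type
  | succ j ih =>
    -- The newest noise in the window at `t + j` is `v (t + j + n) = v (s + 1)`.
    obtain ⟨s, hs⟩ : ∃ s, t + j + n = s + 1 := ⟨t + j + n - 1, by omega⟩
    set X : Ω → (Fin j → (Fin n → ℝ) × (Fin n → Fin l → ℝ)) ×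
      ((Fin n → ℝ) × (Fin n → Fin l → ℝ)) :=
      fun ω => (fun i => D.windows ω (t + i), D.predictedWindow ω (t + j)) with hXdef
    have hX : Measurable[D.pastSpace s] X :=
      (@measurable_pi_lambda _ _ _ (D.pastSpace s) _ _ fun i =>
        D.measurable_windows (by omega)).prodMk
        (D.measurable_predictedWindow hs hn)
    have : StandardBorelSpace ((Fin n → ℝ) × (Fin n → Fin l → ℝ)) := inferInstance
    have : StandardBorelSpace (Fin j → (Fin n → ℝ) × (Fin n → Fin l → ℝ)) :=
      StandardBorelSpace.pi_countable
    obtain ⟨hXm, hXi⟩ := D.indepFun_of_measurable_past hX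
    have hstep := ae_linearIndependent_snoc hV (D.law_v (s + 1)) hXm hXi (noiseWindow l hn)
      fun ω hli hr e he => ?_
    · filter_upwards [ih (by omega), hstep] with ω h1 h2
      have h3 := h2 h1
      rw [← hs, ← D.windows_eq_add hn ω (t + j)] at h3
      have hfun : (fun i : Fin (j + 1) => D.windows ω (t + i)) =
          Fin.snoc (X ω).1 (D.windows ω (t + j)) := by
        ext1 i
        induction i using Fin.lastCases with
        | last => rw [Fin.snoc_last, Fin.val_last]
        | cast i => rw [Fin.snoc_castSucc, Fin.val_castSucc]
      rwa [hfun]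
    · have hnoise (e') : noiseWindow l hn e' ∈ Submodule.span ℝ (Set.range (X ω).1) :=
        hr (LinearMap.mem_range_self _ e')
      -- `e` is an arbitrary noise value; replacing it by the realized one changes the window by an
      -- element of the span.
      have hmem : D.windows ω (t + j) ∈ Submodule.span ℝ (Set.range (X ω).1) := by
        have h := Submodule.add_mem _ he
          (Submodule.sub_mem _ (hnoise (D.v (t + j + n) ω)) (hnoise e))
        rwa [add_add_sub_cancel, ← D.windows_eq_add hn] at h
      have htop : Submodule.span ℝ (Set.range (X ω).1) = ⊤ :=
        D.span_windows_eq_top hn hc hnoise hmem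
      -- A span of `j < n + n * l` vectors cannot be everything.
      have hcard := finrank_span_eq_card hli
      rw [htop, finrank_top] at hcard
      simp [Module.finrank_pi_fintype] at hcard
      omega

end ExpertRun

end LQG

/-! ### Recovery of the estimation matrix from the data. -/

theorem theorem2 {Ω : Type*} [MeasurableSpace Ω] (μ : Measure Ω) [IsProbabilityMeasure μ]
    {n l N : ℕ} (hn : 0 < n)
    -- the plant and the noise covariances
    (A : Matrix (Fin n) (Fin n) ℝ) (B : Matrix (Fin n) (Fin 1) ℝ) (C : Matrix (Fin l) (Fin n) ℝ)
    (W : Matrix (Fin n) (Fin n) ℝ) (V : Matrix (Fin l) (Fin l) ℝ)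
    (hW : W.PosSemidef) (hV : V.PosDef)
    (hAB : LQG.IsControllable A B) (hAW : LQG.IsControllable A (CFC.sqrt W))
    (hAC : LQG.IsObservable A C)
    -- the weights of the source tasks
    (Q : Fin N → Matrix (Fin n) (Fin n) ℝ) (R : Fin N → Matrix (Fin 1) (Fin 1) ℝ)
    (hQ : ∀ i, (Q i).PosSemidef) (hR : ∀ i, (R i).PosDef)
    (hAQ : ∀ i, LQG.IsObservable A (CFC.sqrt (Q i)))
    -- the Kalman gain and the LQR gains of the source tasks
    (L : Matrix (Fin n) (Fin l) ℝ) (hL : LQG.IsKalmanGain A C W V L)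
    (K : Fin N → Matrix (Fin 1) (Fin n) ℝ) (hK : ∀ i, LQG.IsLQRGain A B (Q i) (R i) (K i))
    -- observability and controllability of the controllers, in open and in closed loop
    (hEK : ∀ i, LQG.IsObservable (LQG.ctrlE A C L) (K i))
    (hEL : LQG.IsControllable (LQG.ctrlE A C L) L)
    (hEFL : ∀ i, LQG.IsControllable (LQG.ctrlE A C L + LQG.ctrlF B C L * K i) L)
    -- the coefficients that define the estimation matrix
    (a : Fin n → ℝ) (ha : LQG.ctrlE A C L ^ n = ∑ k : Fin n, a k • LQG.ctrlE A C L ^ (k : ℕ))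
    -- diversity of the source tasks
    (hdiv : ⨅ i, LQG.matKer (Matrix.fromCols (K i) (1 : Matrix (Fin 1) (Fin 1) ℝ)) = ⊥)
    -- the expert runs, the initial times of the recorded windows, and their length
    (D : ∀ i, LQG.ExpertRun μ A B C W V L (K i)) (t : Fin N → ℕ)
    (T : ℕ) (hT : n * (l + 2) - 1 ≤ T) :
    ∀ᵐ ω ∂μ,
      LQG.matKer (LQG.estimationMatrix (LQG.ctrlE A C L) (LQG.ctrlF B C L) L a) =
        LQG.dataKernel n T t (fun i s => (D i).u s ω) (fun i s => (D i).y s ω) ∧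
      (∃ Lhat : Matrix (Fin n ⊕ Fin 1) ((Fin n × Fin 1) ⊕ (Fin n × Fin l)) ℝ,
        LQG.RowsBasisOrthogonal Lhat
          (LQG.dataKernel n T t (fun i s => (D i).u s ω) (fun i s => (D i).y s ω))) ∧
      ∀ Lhat : Matrix (Fin n ⊕ Fin 1) ((Fin n × Fin 1) ⊕ (Fin n × Fin l)) ℝ,
        LQG.RowsBasisOrthogonal Lhat
          (LQG.dataKernel n T t (fun i s => (D i).u s ω) (fun i s => (D i).y s ω)) →
        ∃ P : Matrix (Fin n ⊕ Fin 1) (Fin n ⊕ Fin 1) ℝ, IsUnit P ∧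
          LQG.estimationMatrix (LQG.ctrlE A C L) (LQG.ctrlF B C L) L a = P * Lhat := by
  classical
  -- Diversity excludes `N = 0`, where the intersection would be the whole nonzero space.
  have hN : Nonempty (Fin N) := by
    by_contra hN
    rw [not_nonempty_iff] at hN
    rw [iInf_of_empty] at hdiv
    exact top_ne_bot hdiv
  have ha0 : a ≠ 0 :=
    LQG.coeff_ne_zero hn hV hL (hK hN.some) (hEK hN.some) ha
  have hrow := LQG.linearIndependent_row_estimationMatrix (F := LQG.ctrlF B C L) hEL ha0
  have hT' : n + n * l ≤ T - n + 1 := by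
    rw [Nat.mul_add] at hT
    omega
  have hwin : ∀ᵐ ω ∂μ, ∀ i, LinearIndependent ℝ
      fun j : Fin (n + n * l) => (D i).windows ω (t i + j) :=
    ae_all_iff.2 fun i => (D i).ae_linearIndependent_windows hV hn (hEFL i) (t i) le_rfl
  filter_upwards [hwin] with ω hω
  have hker : LQG.matKer (LQG.estimationMatrix (LQG.ctrlE A C L) (LQG.ctrlF B C L) L a) =
      LQG.dataKernel n T t (fun i s => (D i).u s ω) (fun i s => (D i).y s ω) := by
    have hi (i : Fin N) : LQG.inputRow (fun s => (D i).u s ω) (t i) n (T - n + 1) *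
        LQG.pinv (LQG.dataMatrix (fun s => (D i).u s ω) (fun s => (D i).y s ω) (t i) n
          (T - n + 1)) = Matrix.fromCols (K i) (1 : Matrix (Fin 1) (Fin 1) ℝ) *
        LQG.estimationMatrix (LQG.ctrlE A C L) (LQG.ctrlF B C L) L a := by
      rw [LQG.inputRow_eq (F := LQG.ctrlF B C L) (G := L) (y := fun s => (D i).y s ω) ha
        (fun k => (D i).xhat_succ k ω) (fun k => (D i).u_eq k ω),
        Matrix.mul_assoc, LQG.mul_pinv_eq_one (LQG.linearIndependent_dataMatrix_row (hEK i)
          (fun k => (D i).xhat_succ k ω) (fun k => (D i).u_eq k ω) hT' (hω i)), Matrix.mul_one]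
    ext z
    simp only [LQG.dataKernel, hi, Submodule.mem_iInf, LQG.mem_matKer, ← mulVec_mulVec]
    refine ⟨fun h i => by rw [h, mulVec_zero], fun h => ?_⟩
    -- Diversity is applied to the vector `L_est z`, which every `[K_i 1]` annihilates.
    rw [← Submodule.mem_bot ℝ, ← hdiv]
    simpa only [Submodule.mem_iInf, LQG.mem_matKer] using h
  have hbasis := LQG.rowsBasisOrthogonal_matKer hrow
  rw [hker] at hbasis
  exact ⟨hker, ⟨_, hbasis⟩, fun Lhat h => hbasis.exists_isUnit_mul h⟩
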